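/- Let $1\le\alpha<2$, let $m_1,\dots,m_N>0$ be masses and $c_1,\dots,c_N\in\mathbb{C}$ distinct centers with $c_1=0$, and put $V(z)=\sum_{j=1}^N \frac{m_j}{\alpha|z-c_j|^{\alpha}}$. Let $\delta>0$ and let $y:[-\delta,\delta]\to\mathbb{C}$ be an isolated collision solution of the $N$-center problem with $y(0)=c_1=0$; that is, $y$ is continuous, and for all $t\in[-\delta,\delta]\setminus\{0\}$ one has $y(t)\notin\{c_1,\dots,c_N\}$, $y$ is twice differentiable at $t$ with $$\ddot y(t)=\nabla V(y(t))=-\sum_{j=1}^N\frac{m_j\,(y(t)-c_j)}{|y(t)-c_j|^{\alpha+2}},$$ and $\tfrac12|\dot y(t)|^2-V(y(t))=h$ with a constant $h\in\mathbb{R}$ that is the same for all $t\neq0$ (derivatives at $\pm\delta$ are one-sided). Write $y(t)=|y(t)|e^{i\theta(t)}$ with $\theta$ real-valued and continuous on $[-\delta,0)$ and on $(0,\delta]$. Then the limits $\theta_{\pm}=\lim_{t\to0^{\pm}}\theta(t)$ exist and are finite. Let $$\bar y(t)=\begin{cases}(\mu|t|)^{\frac{2}{\alpha+2}}e^{i\theta_+},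 & t\ge 0,\\ (\mu|t|)^{\frac{2}{\alpha+2}}e^{i\theta_-}, & t\le 0,\end{cases}\qquad \mu=(\alpha+2)\Big(\frac{m_1}{2\alpha}\Big)^{1/2},$$ and, for $\lambda>0$, let $y_\lambda(t)=\lambda^{-\frac{2}{2+\alpha}}y(\lambda t)$ for $t\in[-\delta/\lambda,\delta/\lambda]$. For every $T>0$ there is a strictly decreasing sequence of positive numbers $\lambda_n\to0$, with $\lambda_nT<\delta$ for all $n$, such that 1. $y_{\lambda_n}$ converges uniformly to $\bar y$ on $[-T,T]$; 2. $\dot y_{\lambda_n}$ converges uniformly to $\dot{\bar y}$ on every compact subset of $[-T,T]\setminus\{0\}$. -/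

import Mathlib

namespace NCenter

noncomputable section

/-- The negative potential `V(z) = ∑ⱼ mⱼ / (α |z - cⱼ|^α)` of the planar `N`-center problem. -/
def potential {N : ℕ} (α : ℝ) (m : Fin N → ℝ) (c : Fin N → ℂ) (z : ℂ) : ℝ :=
  ∑ j, m j / (α * ‖z - c j‖ ^ α)

/-- The force field `∇V(z) = - ∑ⱼ mⱼ (z - cⱼ) / |z - cⱼ|^(α+2)`. -/
def force {N : ℕ} (α : ℝ) (m : Fin N → ℝ) (c : Fin N → ℂ) (z : ℂ) : ℂ :=
  -∑ j, (m j / ‖z - c j‖ ^ (α + 2)) • (z - c j)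

/-- `y : [t₀ - δ, t₀ + δ] → ℂ` is an isolated collision solution of the `N`-center problem.
A curve on the closed interval is represented by a function on `ℝ`, of which only the values on
that interval matter; derivatives are taken within the interval (so they are two-sided
at interior points and one-sided at the two end points). -/
structure IsIsolatedCollisionSolution {N : ℕ} (α : ℝ) (m : Fin N → ℝ) (c : Fin N → ℂ)
    (t₀ δ : ℝ) (y : ℝ → ℂ) : Prop where
  delta_pos : 0 < δ
  continuousOn : ContinuousOn y (Set.Icc (t₀ - δ) (t₀ + δ))
  collision : y t₀ ∈ Set.range c
  collisionFree : ∀ t ∈ Set.Icc (t₀ - δ) (t₀ + δ), t ≠ t₀ → y t ∉ Set.range c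
  differentiable : ∀ t ∈ Set.Icc (t₀ - δ) (t₀ + δ), t ≠ t₀ →
    DifferentiableWithinAt ℝ y (Set.Icc (t₀ - δ) (t₀ + δ)) t
  equation : ∀ t ∈ Set.Icc (t₀ - δ) (t₀ + δ), t ≠ t₀ →
    HasDerivWithinAt (derivWithin y (Set.Icc (t₀ - δ) (t₀ + δ))) (force α m c (y t))
      (Set.Icc (t₀ - δ) (t₀ + δ)) t
  energy : ∃ h : ℝ, ∀ t ∈ Set.Icc (t₀ - δ) (t₀ + δ), t ≠ t₀ →
    1 / 2 * ‖derivWithin y (Set.Icc (t₀ - δ) (t₀ + δ)) t‖ ^ 2 - potential α m c (y t) = h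

/-- `θ` is a polar angle of `y` on `[-δ, δ] \ {0}`: it is continuous there, that is, continuous on
each of `[-δ, 0)` and `(0, δ]`, and `y(t) = |y(t)| e^{iθ(t)}`. -/
structure IsPolarAngle (δ : ℝ) (y : ℝ → ℂ) (θ : ℝ → ℝ) : Prop where
  continuousOn : ContinuousOn θ (Set.Icc (-δ) δ \ {0})
  polar : ∀ t ∈ Set.Icc (-δ) δ \ {0}, y t = ‖y t‖ * Complex.exp (θ t * Complex.I)

/-- The constant `μ = (α + 2) (m₁ / (2α))^(1/2)`. -/
def mu (α m₁ : ℝ) : ℝ := (α + 2) * (m₁ / (2 * α)) ^ (1 / 2 : ℝ)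

/-- The parabolic collision-ejection solution with angles `φm` (for `t ≤ 0`) and `φp`
(for `t ≥ 0`) of the Kepler-type problem with mass `m₁`. -/
def collisionEjection (α m₁ φm φp : ℝ) (t : ℝ) : ℂ :=
  if 0 ≤ t then (((mu α m₁ * |t|) ^ (2 / (α + 2)) : ℝ) : ℂ) * Complex.exp (φp * Complex.I)
  else (((mu α m₁ * |t|) ^ (2 / (α + 2)) : ℝ) : ℂ) * Complex.exp (φm * Complex.I)

/-- The `r`-rescale `y_r(t) = r^(-2/(2+α)) y(r t)` with respect to a center at the origin. -/
def rescale (α r : ℝ) (y : ℝ → ℂ) (t : ℝ) : ℂ :=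
  ((r ^ (-(2 / (2 + α))) : ℝ) : ℂ) * y (r * t)

end

end NCenter

/-! Near the collision the other centers contribute only a bounded force `g`, and the motion is a
perturbed Kepler-type problem. With r = |y|, everything is read off conj y · v = r r' + iω, ω being
the angular momentum; its derivative is |v|² - m₁/r^α + conj y · g.

Real part: by energy, |v|² is 2m₁/(α r^α) up to a bounded error, so for α < 2 the derivative is
positive near the collision. Hence r r' increases, and since r → 0 at the collision, r' > 0 after
it. Imaginary part: the central force drops out, ω → 0, and r is monotone, so |ω| ≤ C r t. The
tangential speed ω/r is therefore O(t), and energy leaves r^(α/2) r' → √(2m₁/α). L'Hôpital turns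
this into r ~ (μt)^β with β = 2/(α+2). Then θ' = ω/r² is O(t/r) → 0, so θ has a finite limit.

Thus y/t^β and v/t^(β-1) have limits at 0⁺, and by time reversal the same holds before the
collision. Such power asymptotics are exactly convergence of the blow-ups, along any sequence of
scales tending to 0. -/

namespace NCenter

/-! ### Perturbed Kepler collision: radial monotonicity and angular momentum. -/

open Filter Topology ComplexConjugate

/-- A planar motion `y` with velocity `v` that collides with the origin at time `0⁺`, driven by the
`α`-homogeneous attraction of a mass `m₁` at the origin and a bounded perturbation `g`, with
kinetic energy equal to the Kepler-type potential up to a bounded error. -/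
structure IsPerturbedCollision (α m₁ C : ℝ) (y v g : ℝ → ℂ) : Prop where
  ne_zero : ∀ᶠ t in 𝓝[>] (0 : ℝ), y t ≠ 0
  hasDerivAt : ∀ᶠ t in 𝓝[>] (0 : ℝ), HasDerivAt y (v t) t
  hasDerivAt_velocity : ∀ᶠ t in 𝓝[>] (0 : ℝ),
    HasDerivAt v (-((m₁ / ‖y t‖ ^ (α + 2)) • y t) + g t) t
  norm_perturbation_le : ∀ᶠ t in 𝓝[>] (0 : ℝ), ‖g t‖ ≤ C
  energy_le : ∀ᶠ t in 𝓝[>] (0 : ℝ), |1 / 2 * ‖v t‖ ^ 2 - m₁ / (α * ‖y t‖ ^ α)| ≤ C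
  tendsto_zero : Tendsto y (𝓝[>] 0) (𝓝 0)

theorem exists_forall_Ioo_of_eventually_nhdsGT {P : ℝ → Prop} (h : ∀ᶠ t in 𝓝[>] (0 : ℝ), P t) :
    ∃ a > 0, ∀ t ∈ Set.Ioo 0 a, P t := by
  obtain ⟨a, ha, hs⟩ := mem_nhdsGT_iff_exists_Ioo_subset.1 h
  exact ⟨a, ha, fun t ht => hs ht⟩

/-- A polar angle of a differentiable curve is differentiable, with derivative `Im (y' / y)`. -/
theorem hasDerivAt_polarAngle {y : ℝ → ℂ} {θ : ℝ → ℝ} {t : ℝ} {y' : ℂ}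
    (hy : HasDerivAt y y' t) (hne : y t ≠ 0) (hθ : ContinuousAt θ t)
    (hpolar : ∀ᶠ s in 𝓝 t, y s = ‖y s‖ * Complex.exp (θ s * Complex.I)) :
    HasDerivAt θ (y' / y t).im t := by
  -- The quotient equals 1 at `t`, away from the branch cut; the imaginary part of its logarithm is
  -- `θ s - θ t` once that difference is below π.
  have hlog : HasDerivAt (fun s => Complex.log (y s / y t)) (y' / y t / (y t / y t)) t :=
    (hy.div_const (y t)).clog_real (by simp [hne])
  rw [div_self hne, div_one] at hlog
  have him : HasDerivAt (fun s => (Complex.log (y s / y t)).im) (y' / y t).im t :=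
    Complex.imCLM.hasFDerivAt.comp_hasDerivAt t hlog
  refine (him.add_const (θ t)).congr_of_eventuallyEq ?_
  have hnear : ∀ᶠ s in 𝓝 t, |θ s - θ t| < Real.pi := by
    have : Tendsto (fun s => |θ s - θ t|) (𝓝 t) (𝓝 |θ t - θ t|) :=
      (hθ.tendsto.sub tendsto_const_nhds).abs
    rw [sub_self, abs_zero] at this
    exact this.eventually_lt_const Real.pi_pos
  filter_upwards [hpolar, hnear, hy.continuousAt.eventually_ne hne] with s hs hπ hs0
  have key : y s / y t = ((‖y s‖ / ‖y t‖ : ℝ) : ℂ) *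
      Complex.exp ((θ s - θ t : ℝ) * Complex.I) := by
    rw [hs, hpolar.self_of_nhds]
    push_cast
    rw [sub_mul, Complex.exp_sub]
    simp only [norm_mul, Complex.norm_real, norm_norm, Complex.norm_exp_ofReal_mul_I, mul_one]
    field_simp
  have hpos : 0 < ‖y s‖ / ‖y t‖ := div_pos (norm_pos_iff.2 hs0) (norm_pos_iff.2 hne)
  rw [Complex.log_im, key, Complex.exp_mul_I, Complex.arg_mul_cos_add_sin_mul_I hpos
    ⟨(abs_lt.1 hπ).1, (abs_lt.1 hπ).2.le⟩]
  ring

namespace IsPerturbedCollision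

variable {α m₁ C : ℝ} {y v g : ℝ → ℂ}

/-- The real part is the Lagrange–Jacobi identity, the imaginary part the angular momentum law, to
which the central force contributes nothing. -/
theorem hasDerivAt_conj_mul (h : IsPerturbedCollision α m₁ C y v g) :
    ∀ᶠ t in 𝓝[>] (0 : ℝ), HasDerivAt (fun s => conj (y s) * v s)
      (((‖v t‖ ^ 2 - m₁ / ‖y t‖ ^ α : ℝ) : ℂ) + conj (y t) * g t) t := by
  filter_upwards [h.ne_zero, h.hasDerivAt, h.hasDerivAt_velocity] with t h0 h1 h2
  have h3 : HasDerivAt (fun s => conj (y s)) (conj (v t)) t :=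
    Complex.conjCLE.hasFDerivAt.comp_hasDerivAt t h1
  refine (h3.mul h2).congr_deriv ?_
  have hr : 0 < ‖y t‖ := norm_pos_iff.2 h0
  have e1 : conj (v t) * v t = ((‖v t‖ ^ 2 : ℝ) : ℂ) := by
    rw [Complex.conj_mul']; push_cast; rfl
  have e2 : conj (y t) * y t = ((‖y t‖ ^ 2 : ℝ) : ℂ) := by
    rw [Complex.conj_mul']; push_cast; rfl
  have e3 : m₁ / ‖y t‖ ^ (α + 2) * ‖y t‖ ^ 2 = m₁ / ‖y t‖ ^ α := by
    rw [Real.rpow_add hr, Real.rpow_two]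
    field_simp
  calc conj (v t) * v t + conj (y t) * (-((m₁ / ‖y t‖ ^ (α + 2)) • y t) + g t)
      = conj (v t) * v t - ((m₁ / ‖y t‖ ^ (α + 2) : ℝ) : ℂ) * (conj (y t) * y t)
          + conj (y t) * g t := by
        rw [Complex.real_smul]; ring
    _ = _ := by
        rw [e1, e2, ← e3]; push_cast; ring

theorem tendsto_norm (h : IsPerturbedCollision α m₁ C y v g) :
    Tendsto (fun t => ‖y t‖) (𝓝[>] 0) (𝓝[>] 0) := by
  refine tendsto_nhdsWithin_iff.2 ⟨by simpa using h.tendsto_zero.norm, ?_⟩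
  filter_upwards [h.ne_zero] with t ht using norm_pos_iff.2 ht

theorem hasDerivAt_norm (h : IsPerturbedCollision α m₁ C y v g) :
    ∀ᶠ t in 𝓝[>] (0 : ℝ),
      HasDerivAt (fun s => ‖y s‖) ((conj (y t) * v t).re / ‖y t‖) t := by
  filter_upwards [h.ne_zero, h.hasDerivAt] with t h0 h1
  have h2 := h1.norm_sq.sqrt (by simpa using h0)
  simp only [Real.sqrt_sq (norm_nonneg _)] at h2
  refine h2.congr_deriv ?_
  rw [Complex.inner, mul_comm (v t)]
  field_simp

/-- Energy leaves the main term (2/α - 1) m₁ r^(-α), which blows up because α < 2. -/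
theorem eventually_deriv_re_pos (h : IsPerturbedCollision α m₁ C y v g)
    (hα : 0 < α) (hα₂ : α < 2) (hm : 0 < m₁) :
    ∀ᶠ t in 𝓝[>] (0 : ℝ),
      0 < ‖v t‖ ^ 2 - m₁ / ‖y t‖ ^ α + (conj (y t) * g t).re := by
  have hbig : Tendsto (fun t => ‖y t‖ ^ (-α)) (𝓝[>] 0) atTop :=
    (tendsto_rpow_neg_nhdsGT_zero (by linarith)).comp h.tendsto_norm
  have hκ : 0 < (2 / α - 1) * m₁ := by
    refine mul_pos ?_ hm
    rw [sub_pos, lt_div_iff₀ hα]; linarith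
  have hsmall := (tendsto_nhdsWithin_iff.1 h.tendsto_norm).1.eventually_lt_const one_pos
  -- The threshold 3C absorbs 2C from the doubled energy error and C from the perturbation, where
  -- |y| < 1.
  filter_upwards [h.ne_zero, h.norm_perturbation_le, h.energy_le, hsmall,
    (hbig.const_mul_atTop hκ).eventually_gt_atTop (3 * C)] with t h0 hg hE hlt hgt
  have hr : 0 < ‖y t‖ := norm_pos_iff.2 h0
  have h1 : |(conj (y t) * g t).re| ≤ C := by
    refine (Complex.abs_re_le_norm _).trans ?_
    rw [norm_mul, RCLike.norm_conj]
    nlinarith [norm_nonneg (g t)]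
  have h2 := (abs_le.1 hE).1
  have e1 : m₁ / ‖y t‖ ^ α = m₁ * ‖y t‖ ^ (-α) := by rw [Real.rpow_neg hr.le]; rfl
  have e2 : m₁ / (α * ‖y t‖ ^ α) = m₁ * ‖y t‖ ^ (-α) / α := by
    rw [Real.rpow_neg hr.le]; field_simp
  have e3 : (2 / α - 1) * m₁ * ‖y t‖ ^ (-α)
      = 2 * (m₁ * ‖y t‖ ^ (-α) / α) - m₁ * ‖y t‖ ^ (-α) := by ring
  rw [e1]
  rw [e2] at h2
  rw [e3] at hgt
  linarith [(abs_le.1 h1).1]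

/-- Since r r' is strictly increasing, a nonpositive value at `t` would make r nonincreasing on `(0,
t]`, which is incompatible with r → 0 and r > 0. -/
theorem eventually_re_pos (h : IsPerturbedCollision α m₁ C y v g)
    (hα : 0 < α) (hα₂ : α < 2) (hm : 0 < m₁) :
    ∀ᶠ t in 𝓝[>] (0 : ℝ), 0 < (conj (y t) * v t).re := by
  obtain ⟨a, ha, H⟩ := exists_forall_Ioo_of_eventually_nhdsGT
    (((h.eventually_deriv_re_pos hα hα₂ hm).and h.hasDerivAt_conj_mul).and
      (h.hasDerivAt_norm.and h.ne_zero))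
  have hre : ∀ t ∈ Set.Ioo 0 a, HasDerivAt (fun s => (conj (y s) * v s).re)
      (‖v t‖ ^ 2 - m₁ / ‖y t‖ ^ α + (conj (y t) * g t).re) t := fun t ht => by
    have := Complex.reCLM.hasFDerivAt.comp_hasDerivAt t (H t ht).1.2
    refine this.congr_deriv ?_
    simp only [Complex.reCLM_apply, Complex.add_re, Complex.ofReal_re]
  have hmono : StrictMonoOn (fun s => (conj (y s) * v s).re) (Set.Ioo 0 a) := by
    refine strictMonoOn_of_hasDerivWithinAt_pos (convex_Ioo 0 a)
      (fun t ht => (hre t ht).continuousAt.continuousWithinAt)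
      (f' := fun t => ‖v t‖ ^ 2 - m₁ / ‖y t‖ ^ α + (conj (y t) * g t).re) ?_ ?_
    · rw [interior_Ioo]
      exact fun t ht => (hre t ht).hasDerivWithinAt
    · rw [interior_Ioo]
      exact fun t ht => (H t ht).1.1
  filter_upwards [Ioo_mem_nhdsGT ha] with t ht
  by_contra! hneg
  have hsub : Set.Ioc 0 t ⊆ Set.Ioo 0 a := fun s hs => ⟨hs.1, hs.2.trans_lt ht.2⟩
  have hanti : AntitoneOn (fun s => ‖y s‖) (Set.Ioc 0 t) := by
    refine antitoneOn_of_hasDerivWithinAt_nonpos (convex_Ioc 0 t)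
      (fun s hs => (H s (hsub hs)).2.1.continuousAt.continuousWithinAt)
      (f' := fun s => (conj (y s) * v s).re / ‖y s‖) ?_ ?_
    · exact fun s hs => (H s (hsub (interior_subset hs))).2.1.hasDerivWithinAt
    · intro s hs
      have hs' := interior_subset hs
      exact div_nonpos_of_nonpos_of_nonneg
        ((hmono.monotoneOn (hsub hs') ht hs'.2).trans hneg) (norm_nonneg _)
  have hlim := (tendsto_nhdsWithin_iff.1 h.tendsto_norm).1
  have : ‖y t‖ ≤ 0 := by
    refine ge_of_tendsto hlim ?_
    filter_upwards [Ioc_mem_nhdsGT ht.1] with s hs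
    exact hanti hs ⟨ht.1, le_rfl⟩ hs.2
  exact (H t ht).2.2 (norm_le_zero_iff.1 this)

theorem exists_monotoneOn_norm (h : IsPerturbedCollision α m₁ C y v g)
    (hα : 0 < α) (hα₂ : α < 2) (hm : 0 < m₁) :
    ∃ a > 0, MonotoneOn (fun s => ‖y s‖) (Set.Ioo 0 a) := by
  obtain ⟨a, ha, H⟩ := exists_forall_Ioo_of_eventually_nhdsGT
    ((h.eventually_re_pos hα hα₂ hm).and h.hasDerivAt_norm)
  refine ⟨a, ha, monotoneOn_of_hasDerivWithinAt_nonneg (convex_Ioo 0 a)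
    (fun s hs => (H s hs).2.continuousAt.continuousWithinAt)
    (f' := fun s => (conj (y s) * v s).re / ‖y s‖) ?_ ?_⟩
  · exact fun s hs => (H s (interior_subset hs)).2.hasDerivWithinAt
  · exact fun s hs => div_nonneg (H s (interior_subset hs)).1.le (norm_nonneg _)

/-- The rescaled kinetic energy `r ^ α |v|²` tends to `2 m₁ / α` at the collision. -/
theorem tendsto_rpow_mul_norm_velocity_sq (h : IsPerturbedCollision α m₁ C y v g)
    (hα : 0 < α) :
    Tendsto (fun t => ‖y t‖ ^ α * ‖v t‖ ^ 2) (𝓝[>] 0) (𝓝 (2 * m₁ / α)) := by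
  have hr0 : Tendsto (fun t => ‖y t‖ ^ α) (𝓝[>] 0) (𝓝 0) := by
    have := (tendsto_nhdsWithin_iff.1 h.tendsto_norm).1.rpow_const (p := α) (Or.inr hα.le)
    rwa [Real.zero_rpow hα.ne'] at this
  have hz : Tendsto (fun t => ‖y t‖ ^ α * ‖v t‖ ^ 2 - 2 * m₁ / α) (𝓝[>] 0) (𝓝 0) := by
    refine squeeze_zero_norm' ?_ (by simpa using hr0.const_mul (2 * C))
    filter_upwards [h.ne_zero, h.energy_le] with t h0 hE
    have hr : 0 < ‖y t‖ ^ α := Real.rpow_pos_of_pos (norm_pos_iff.2 h0) _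
    have e : ‖y t‖ ^ α * ‖v t‖ ^ 2 - 2 * m₁ / α
        = 2 * ‖y t‖ ^ α * (1 / 2 * ‖v t‖ ^ 2 - m₁ / (α * ‖y t‖ ^ α)) := by
      field_simp
    rw [e, Real.norm_eq_abs, abs_mul, abs_of_pos (by positivity)]
    nlinarith
  simpa using hz.add_const (2 * m₁ / α)

/-- Cauchy–Schwarz: |ω| ≤ r|v| = √(r^(2-α) · r^α|v|²), with 2 - α > 0. -/
theorem tendsto_angularMomentum (h : IsPerturbedCollision α m₁ C y v g)
    (hα : 0 < α) (hα₂ : α < 2) :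
    Tendsto (fun t => (conj (y t) * v t).im) (𝓝[>] 0) (𝓝 0) := by
  have h1 : Tendsto (fun t => ‖y t‖ ^ (2 - α)) (𝓝[>] 0) (𝓝 0) := by
    have := (tendsto_nhdsWithin_iff.1 h.tendsto_norm).1.rpow_const (p := 2 - α)
      (Or.inr (by linarith))
    rwa [Real.zero_rpow (by linarith)] at this
  have h2 := ((h1.mul (h.tendsto_rpow_mul_norm_velocity_sq hα)).sqrt)
  rw [zero_mul, Real.sqrt_zero] at h2
  refine squeeze_zero_norm' ?_ h2
  filter_upwards [h.ne_zero] with t h0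
  refine (Complex.abs_im_le_norm _).trans ?_
  rw [norm_mul, RCLike.norm_conj]
  refine Real.le_sqrt_of_sq_le (le_of_eq ?_)
  rw [← mul_assoc, ← Real.rpow_add (norm_pos_iff.2 h0), sub_add_cancel, Real.rpow_two, mul_pow]

/-- The torque Im(conj y · g) is at most C r(t) on `(0, t]` by monotonicity of r; the mean value
inequality on `[s, t]`, with s → 0, gives the bound. -/
theorem abs_angularMomentum_le (h : IsPerturbedCollision α m₁ C y v g)
    (hα : 0 < α) (hα₂ : α < 2) (hm : 0 < m₁) :
    ∀ᶠ t in 𝓝[>] (0 : ℝ), |(conj (y t) * v t).im| ≤ C * ‖y t‖ * t := by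
  obtain ⟨a, ha, hmono⟩ := h.exists_monotoneOn_norm hα hα₂ hm
  obtain ⟨b, hb, H⟩ := exists_forall_Ioo_of_eventually_nhdsGT
    (h.hasDerivAt_conj_mul.and h.norm_perturbation_le)
  filter_upwards [Ioo_mem_nhdsGT ha, Ioo_mem_nhdsGT hb] with t hta htb
  have hlim : Tendsto (fun s => |(conj (y t) * v t).im - (conj (y s) * v s).im|) (𝓝[>] 0)
      (𝓝 |(conj (y t) * v t).im - 0|) :=
    (tendsto_const_nhds.sub (h.tendsto_angularMomentum hα hα₂)).abs
  rw [sub_zero] at hlim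
  have hC : 0 ≤ C := (norm_nonneg _).trans (H t htb).2
  refine le_of_tendsto hlim ?_
  filter_upwards [Ioo_mem_nhdsGT hta.1] with s hs
  have hsub : ∀ u ∈ Set.Icc s t, u ∈ Set.Ioo 0 a ∧ u ∈ Set.Ioo 0 b := fun u hu =>
    ⟨⟨hs.1.trans_le hu.1, hu.2.trans_lt hta.2⟩, ⟨hs.1.trans_le hu.1, hu.2.trans_lt htb.2⟩⟩
  have hder : ∀ u ∈ Set.Icc s t, HasDerivWithinAt (fun s => (conj (y s) * v s).im)
      (conj (y u) * g u).im (Set.Icc s t) u := fun u hu => by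
    have := Complex.imCLM.hasFDerivAt.comp_hasDerivAt u (H u (hsub u hu).2).1
    refine HasDerivAt.hasDerivWithinAt (this.congr_deriv ?_)
    simp only [Complex.imCLM_apply, Complex.add_im, Complex.ofReal_im, zero_add]
  have hbd : ∀ u ∈ Set.Icc s t, ‖(conj (y u) * g u).im‖ ≤ C * ‖y t‖ := fun u hu => by
    refine (Complex.abs_im_le_norm _).trans ?_
    rw [norm_mul, RCLike.norm_conj, mul_comm]
    exact mul_le_mul (H u (hsub u hu).2).2 (hmono (hsub u hu).1 hta hu.2) (norm_nonneg _) hC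
  refine (Convex.norm_image_sub_le_of_norm_hasDerivWithin_le hder hbd (convex_Icc s t)
    ⟨le_rfl, hs.2.le⟩ ⟨hs.2.le, le_rfl⟩).trans ?_
  rw [Real.norm_of_nonneg (by linarith [hs.2])]
  exact mul_le_mul_of_nonneg_left (by linarith [hs.1]) (by positivity)

/-- The radial velocity `r' = Re (conj y * v) / r` satisfies `r ^ (α / 2) r' → (2 m₁ / α) ^ (1 / 2)`
at the collision. -/
theorem tendsto_rpow_mul_radialVelocity (h : IsPerturbedCollision α m₁ C y v g)
    (hα : 0 < α) (hα₂ : α < 2) (hm : 0 < m₁) :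
    Tendsto (fun t => ‖y t‖ ^ (α / 2) * ((conj (y t) * v t).re / ‖y t‖)) (𝓝[>] 0)
      (𝓝 (√(2 * m₁ / α))) := by
  have hr0 : Tendsto (fun t => ‖y t‖ ^ α) (𝓝[>] 0) (𝓝 0) := by
    have := (tendsto_nhdsWithin_iff.1 h.tendsto_norm).1.rpow_const (p := α) (Or.inr hα.le)
    rwa [Real.zero_rpow hα.ne'] at this
  have ht0 : Tendsto (fun t : ℝ => t) (𝓝[>] 0) (𝓝 0) := nhdsWithin_le_nhds
  have hω : Tendsto (fun t => (conj (y t) * v t).im / ‖y t‖) (𝓝[>] 0) (𝓝 0) := by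
    refine squeeze_zero_norm' ?_ (by simpa using ht0.const_mul C)
    filter_upwards [h.abs_angularMomentum_le hα hα₂ hm, h.ne_zero] with t ht h0
    have hr : 0 < ‖y t‖ := norm_pos_iff.2 h0
    rw [norm_div, norm_norm, Real.norm_eq_abs, div_le_iff₀ hr]
    linarith
  have hsq := ((h.tendsto_rpow_mul_norm_velocity_sq hα).sub (hr0.mul (hω.pow 2))).sqrt
  simp only [zero_mul, sub_zero] at hsq
  refine hsq.congr' ?_
  filter_upwards [h.eventually_re_pos hα hα₂ hm, h.ne_zero] with t hp h0
  have hr : 0 < ‖y t‖ := norm_pos_iff.2 h0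
  refine (Real.sqrt_eq_iff_mul_self_eq_of_pos (by positivity)).2 ?_
  have e1 : ‖y t‖ ^ (α / 2) * ‖y t‖ ^ (α / 2) = ‖y t‖ ^ α := by
    rw [← Real.rpow_add hr, add_halves]
  have e2 : (conj (y t) * v t).re ^ 2 + (conj (y t) * v t).im ^ 2 = ‖y t‖ ^ 2 * ‖v t‖ ^ 2 := by
    rw [← mul_pow, ← RCLike.norm_conj (y t), ← norm_mul, Complex.sq_norm, Complex.normSq_apply,
      sq, sq]
  rw [mul_mul_mul_comm, e1, ← mul_sub]
  congr 1
  field_simp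
  linarith

end IsPerturbedCollision

end NCenter

/-! ### Asymptotics of radius, angle, position and velocity. -/

namespace NCenter

open Filter Topology ComplexConjugate

theorem mu_pos {α m₁ : ℝ} (hα : 0 < α) (hm : 0 < m₁) : 0 < mu α m₁ := by
  unfold mu; positivity

theorem mu_eq {α m₁ : ℝ} (hα : 0 < α) (hm : 0 < m₁) :
    mu α m₁ = √(2 * m₁ / α) * ((α + 2) / 2) := by
  have : √(2 * m₁ / α) = 2 * √(m₁ / (2 * α)) := by
    rw [show 2 * m₁ / α = 2 ^ 2 * (m₁ / (2 * α)) by field_simp,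
      Real.sqrt_mul (by norm_num), Real.sqrt_sq (by norm_num)]
  rw [mu, ← Real.sqrt_eq_rpow, this]
  ring

namespace IsPerturbedCollision

variable {α m₁ C : ℝ} {y v g : ℝ → ℂ}

/-- L'Hôpital: the numerator has derivative (α+2)/2 · r^(α/2) r', whose limit is μ. -/
theorem tendsto_norm_rpow_div (h : IsPerturbedCollision α m₁ C y v g)
    (hα : 0 < α) (hα₂ : α < 2) (hm : 0 < m₁) :
    Tendsto (fun t => ‖y t‖ ^ ((α + 2) / 2) / t) (𝓝[>] 0) (𝓝 (mu α m₁)) := by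
  have hq : 0 < (α + 2) / 2 := by linarith
  refine HasDerivAt.lhopital_zero_nhdsGT
    (f' := fun t => (‖y t‖ ^ (α / 2) * ((conj (y t) * v t).re / ‖y t‖)) * ((α + 2) / 2))
    (g' := fun _ => 1) ?_ (.of_forall fun t => hasDerivAt_id t) (by simp) ?_
    nhdsWithin_le_nhds ?_
  · filter_upwards [h.hasDerivAt_norm, h.ne_zero] with t ht h0
    refine (ht.rpow_const (p := (α + 2) / 2) (Or.inl (norm_ne_zero_iff.2 h0))).congr_deriv ?_
    rw [show (α + 2) / 2 - 1 = α / 2 by ring]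
    ring
  · have := (tendsto_nhdsWithin_iff.1 h.tendsto_norm).1.rpow_const (p := (α + 2) / 2)
      (Or.inr hq.le)
    rwa [Real.zero_rpow hq.ne'] at this
  · simp only [div_one]
    rw [mu_eq hα hm]
    exact (h.tendsto_rpow_mul_radialVelocity hα hα₂ hm).mul_const _

/-- The radius is asymptotic to `(μ t) ^ (2 / (α + 2))` at the collision. -/
theorem tendsto_norm_div_rpow (h : IsPerturbedCollision α m₁ C y v g)
    (hα : 0 < α) (hα₂ : α < 2) (hm : 0 < m₁) :
    Tendsto (fun t => ‖y t‖ / t ^ (2 / (α + 2))) (𝓝[>] 0)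
      (𝓝 (mu α m₁ ^ (2 / (α + 2)))) := by
  have := (h.tendsto_norm_rpow_div hα hα₂ hm).rpow_const (p := 2 / (α + 2))
    (Or.inr (by positivity))
  refine this.congr' ?_
  filter_upwards [self_mem_nhdsWithin] with t ht
  rw [Real.div_rpow (by positivity) (le_of_lt ht), ← Real.rpow_mul (norm_nonneg _),
    show (α + 2) / 2 * (2 / (α + 2)) = 1 by field_simp, Real.rpow_one]

/-- The polar angle has a finite limit at the collision. -/
theorem exists_tendsto_polarAngle (h : IsPerturbedCollision α m₁ C y v g)
    (hα : 0 < α) (hα₂ : α < 2) (hm : 0 < m₁) {θ : ℝ → ℝ}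
    (hθ : ∀ᶠ t in 𝓝[>] (0 : ℝ), ContinuousAt θ t)
    (hpolar : ∀ᶠ t in 𝓝[>] (0 : ℝ), y t = ‖y t‖ * Complex.exp (θ t * Complex.I)) :
    ∃ θ₀, Tendsto θ (𝓝[>] 0) (𝓝 θ₀) := by
  have hβ : 2 / (α + 2) < 1 := by rw [div_lt_one (by linarith)]; linarith
  have hμ := Real.rpow_pos_of_pos (mu_pos hα hm) (2 / (α + 2))
  -- This is the bound C t / r for |θ'|, written so that the radial asymptotics apply.
  have hsmall : Tendsto (fun t : ℝ => C * (t ^ (1 - 2 / (α + 2)) / (‖y t‖ / t ^ (2 / (α + 2)))))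
      (𝓝[>] 0) (𝓝 0) := by
    have ht0 : Tendsto (fun t : ℝ => t) (𝓝[>] 0) (𝓝 0) := nhdsWithin_le_nhds
    have h1 := ht0.rpow_const (p := 1 - 2 / (α + 2)) (Or.inr (by linarith))
    rw [Real.zero_rpow (by linarith)] at h1
    simpa using (h1.div (h.tendsto_norm_div_rpow hα hα₂ hm) hμ.ne').const_mul C
  obtain ⟨a, ha, H⟩ := exists_forall_Ioo_of_eventually_nhdsGT
    ((((hsmall.eventually_lt_const one_pos).and (h.abs_angularMomentum_le hα hα₂ hm)).and
      (h.ne_zero.and h.hasDerivAt)).and (hθ.and hpolar))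
  have hder : ∀ t ∈ Set.Ioo 0 a, HasDerivWithinAt θ (v t / y t).im (Set.Ioo 0 a) t := by
    intro t ht
    obtain ⟨⟨-, h0, h1⟩, h2, -⟩ := H t ht
    refine (hasDerivAt_polarAngle h1 h0 h2 ?_).hasDerivWithinAt
    filter_upwards [Ioo_mem_nhds ht.1 ht.2] with s hs using (H s hs).2.2
  have hlip : LipschitzOnWith 1 θ (Set.Ioo 0 a) := by
    refine (convex_Ioo 0 a).lipschitzOnWith_of_nnnorm_hasDerivWithin_le hder fun t ht => ?_
    obtain ⟨⟨⟨h1, h2⟩, h0, -⟩, -⟩ := H t ht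
    have hr : 0 < ‖y t‖ := norm_pos_iff.2 h0
    have ht0 : 0 < t := ht.1
    have e1 : (v t / y t).im = (conj (y t) * v t).im / ‖y t‖ ^ 2 := by
      have : v t / y t = conj (y t) * v t / ((‖y t‖ ^ 2 : ℝ) : ℂ) := by
        push_cast
        rw [← Complex.conj_mul', mul_div_mul_left _ _ ((map_ne_zero _).2 h0)]
      rw [this, Complex.div_ofReal_im]
    have e2 : C * (t ^ (1 - 2 / (α + 2)) / (‖y t‖ / t ^ (2 / (α + 2)))) = C * t / ‖y t‖ := by
      have : t ^ (1 - 2 / (α + 2)) * t ^ (2 / (α + 2)) = t := by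
        rw [← Real.rpow_add ht0, sub_add_cancel, Real.rpow_one]
      rw [div_div_eq_mul_div, this, mul_div_assoc]
    rw [e2, div_lt_one hr] at h1
    rw [← NNReal.coe_le_coe, coe_nnnorm, e1, norm_div, norm_pow, norm_norm, Real.norm_eq_abs,
      NNReal.coe_one, div_le_one (by positivity)]
    nlinarith
  -- A Lipschitz extension to ℝ is continuous at 0, and its value there is the limiting angle.
  obtain ⟨f, hf, hfθ⟩ := hlip.extend_real
  refine ⟨f 0, (hf.continuous.continuousAt.tendsto.mono_left nhdsWithin_le_nhds).congr' ?_⟩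
  filter_upwards [Ioo_mem_nhdsGT ha] with t ht using (hfθ ht).symm

theorem tendsto_position (h : IsPerturbedCollision α m₁ C y v g)
    (hα : 0 < α) (hα₂ : α < 2) (hm : 0 < m₁) {θ : ℝ → ℝ} {θ₀ : ℝ}
    (hθ : Tendsto θ (𝓝[>] 0) (𝓝 θ₀))
    (hpolar : ∀ᶠ t in 𝓝[>] (0 : ℝ), y t = ‖y t‖ * Complex.exp (θ t * Complex.I)) :
    Tendsto (fun t => y t / ((t ^ (2 / (α + 2)) : ℝ) : ℂ)) (𝓝[>] 0)
      (𝓝 (((mu α m₁ ^ (2 / (α + 2)) : ℝ) : ℂ) * Complex.exp (θ₀ * Complex.I))) := by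
  have h1 : Tendsto (fun t => Complex.exp (θ t * Complex.I)) (𝓝[>] 0)
      (𝓝 (Complex.exp (θ₀ * Complex.I))) :=
    (((Complex.continuous_ofReal.tendsto _).comp hθ).mul_const _).cexp
  refine (((Complex.continuous_ofReal.tendsto _).comp
    (h.tendsto_norm_div_rpow hα hα₂ hm)).mul h1).congr' ?_
  filter_upwards [hpolar] with t ht
  conv_rhs => rw [ht]
  simp only [Function.comp_apply, Complex.ofReal_div]
  ring

/-- In the moving frame v = (r' + iω/r) e^{iθ}: r' has the order t^(β-1), with β = 2/(α+2), while
ω/r = O(t) is negligible. -/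
theorem tendsto_velocity (h : IsPerturbedCollision α m₁ C y v g)
    (hα : 0 < α) (hα₂ : α < 2) (hm : 0 < m₁) {θ : ℝ → ℝ} {θ₀ : ℝ}
    (hθ : Tendsto θ (𝓝[>] 0) (𝓝 θ₀))
    (hpolar : ∀ᶠ t in 𝓝[>] (0 : ℝ), y t = ‖y t‖ * Complex.exp (θ t * Complex.I)) :
    Tendsto (fun t => v t / ((t ^ (2 / (α + 2) - 1) : ℝ) : ℂ)) (𝓝[>] 0)
      (𝓝 (((2 / (α + 2) * mu α m₁ ^ (2 / (α + 2)) : ℝ) : ℂ) * Complex.exp (θ₀ * Complex.I))) := by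
  have hμ := mu_pos hα hm
  have hβ : 2 / (α + 2) < 1 := by rw [div_lt_one (by linarith)]; linarith
  have hexp : 2 / (α + 2) * (-(α / 2)) = 2 / (α + 2) - 1 := by field_simp; ring
  have h1 : Tendsto (fun t => Complex.exp (θ t * Complex.I)) (𝓝[>] 0)
      (𝓝 (Complex.exp (θ₀ * Complex.I))) :=
    (((Complex.continuous_ofReal.tendsto _).comp hθ).mul_const _).cexp
  have hrad : Tendsto (fun t => (conj (y t) * v t).re / ‖y t‖ / t ^ (2 / (α + 2) - 1)) (𝓝[>] 0)
      (𝓝 (2 / (α + 2) * mu α m₁ ^ (2 / (α + 2)))) := by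
    have h2 := (h.tendsto_rpow_mul_radialVelocity hα hα₂ hm).mul
      ((h.tendsto_norm_div_rpow hα hα₂ hm).rpow_const (p := -(α / 2))
        (Or.inl (Real.rpow_pos_of_pos hμ _).ne'))
    have e : √(2 * m₁ / α) * (mu α m₁ ^ (2 / (α + 2))) ^ (-(α / 2))
        = 2 / (α + 2) * mu α m₁ ^ (2 / (α + 2)) := by
      rw [← Real.rpow_mul hμ.le, hexp, Real.rpow_sub hμ, Real.rpow_one]
      have : √(2 * m₁ / α) = 2 / (α + 2) * mu α m₁ := by
        rw [mu_eq hα hm]; field_simp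
      rw [this]
      field_simp
    rw [e] at h2
    refine h2.congr' ?_
    filter_upwards [h.ne_zero, self_mem_nhdsWithin] with t h0 ht
    have ht0 : 0 < t := ht
    have hr : 0 < ‖y t‖ := norm_pos_iff.2 h0
    rw [Real.div_rpow hr.le (by positivity), ← Real.rpow_mul ht0.le, hexp, Real.rpow_neg hr.le]
    have := Real.rpow_pos_of_pos hr (α / 2)
    field_simp
  have hang : Tendsto (fun t => (conj (y t) * v t).im / ‖y t‖ / t ^ (2 / (α + 2) - 1)) (𝓝[>] 0)
      (𝓝 0) := by
    have ht0 : Tendsto (fun t : ℝ => t) (𝓝[>] 0) (𝓝 0) := nhdsWithin_le_nhds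
    have h3 := (ht0.rpow_const (p := 2 - 2 / (α + 2)) (Or.inr (by linarith))).const_mul C
    rw [Real.zero_rpow (by linarith), mul_zero] at h3
    refine squeeze_zero_norm' ?_ h3
    filter_upwards [h.ne_zero, self_mem_nhdsWithin, h.abs_angularMomentum_le hα hα₂ hm]
      with t h0 ht hω
    have ht0 : 0 < t := ht
    have hr : 0 < ‖y t‖ := norm_pos_iff.2 h0
    have hp := Real.rpow_pos_of_pos ht0 (2 / (α + 2) - 1)
    rw [norm_div, norm_div, norm_norm, Real.norm_eq_abs, Real.norm_of_nonneg hp.le,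
      div_le_iff₀ hp, div_le_iff₀ hr, mul_assoc C, ← Real.rpow_add ht0,
      show 2 - 2 / (α + 2) + (2 / (α + 2) - 1) = 1 by ring, Real.rpow_one]
    linarith
  have hsum := (((Complex.continuous_ofReal.tendsto _).comp hrad).add
    (((Complex.continuous_ofReal.tendsto _).comp hang).mul_const Complex.I)).mul h1
  simp only [Complex.ofReal_zero, zero_mul, add_zero] at hsum
  refine hsum.congr' ?_
  filter_upwards [h.ne_zero, hpolar] with t h0 ht
  have hr : (‖y t‖ : ℂ) ≠ 0 := by simpa using h0
  have e : v t = (conj (y t) * v t) / ‖y t‖ * Complex.exp (θ t * Complex.I) := by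
    have h4 : Complex.exp (θ t * Complex.I) = y t / ‖y t‖ := by
      rw [eq_div_iff hr, mul_comm]; exact ht.symm
    rw [h4, div_mul_div_comm, mul_right_comm, Complex.conj_mul']
    field_simp
  conv_rhs => rw [e, ← Complex.re_add_im (conj (y t) * v t)]
  simp only [Function.comp_apply, Complex.ofReal_div]
  ring

end IsPerturbedCollision

end NCenter

/-! ### From the N-center problem to the perturbed collision. -/

namespace NCenter

open Filter Topology ComplexConjugate

/-- The other centers are distinct from 0, so their force `G` and potential `P` are continuous at 0,
hence bounded along the orbit near the collision. -/
theorem exists_isPerturbedCollision {N : ℕ} {α h : ℝ} {m : Fin N → ℝ} {c : Fin N → ℂ}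
    (hc : Function.Injective c) {k : Fin N} (hk : c k = 0) {y v : ℝ → ℂ}
    (hfree : ∀ᶠ t in 𝓝[>] (0 : ℝ), y t ∉ Set.range c)
    (hy : ∀ᶠ t in 𝓝[>] (0 : ℝ), HasDerivAt y (v t) t)
    (hv : ∀ᶠ t in 𝓝[>] (0 : ℝ), HasDerivAt v (force α m c (y t)) t)
    (henergy : ∀ᶠ t in 𝓝[>] (0 : ℝ), 1 / 2 * ‖v t‖ ^ 2 - potential α m c (y t) = h)
    (hlim : Tendsto y (𝓝[>] 0) (𝓝 0)) :
    ∃ C, ∃ g : ℝ → ℂ, IsPerturbedCollision α (m k) C y v g := by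
  have hcj : ∀ j ∈ Finset.univ.erase k, ‖(0 : ℂ) - c j‖ ≠ 0 := fun j hj => by
    rw [norm_ne_zero_iff, sub_ne_zero, ← hk]
    exact fun e => (Finset.ne_of_mem_erase hj) (hc e).symm
  have hnorm : ∀ j, ContinuousAt (fun z : ℂ => ‖z - c j‖) 0 := fun j => by fun_prop
  set G : ℂ → ℂ := fun z =>
    -∑ j ∈ Finset.univ.erase k, (m j / ‖z - c j‖ ^ (α + 2)) • (z - c j) with hG
  set P : ℂ → ℝ := fun z => ∑ j ∈ Finset.univ.erase k, m j / (α * ‖z - c j‖ ^ α) with hP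
  have hGc : ContinuousAt G 0 := by
    refine (tendsto_finsetSum _ fun j hj => ?_).neg
    refine Tendsto.smul (tendsto_const_nhds.div ((hnorm j).rpow_const (Or.inl (hcj j hj))) ?_)
      (Continuous.tendsto (by fun_prop) _)
    exact (Real.rpow_pos_of_pos ((norm_nonneg _).lt_of_ne' (hcj j hj)) _).ne'
  have hforce : ∀ z, force α m c z = -((m k / ‖z‖ ^ (α + 2)) • z) + G z := fun z => by
    rw [force, ← Finset.add_sum_erase _ _ (Finset.mem_univ k), hk, sub_zero, neg_add]
  have hpot : ∀ z, potential α m c z = m k / (α * ‖z‖ ^ α) + P z := fun z => by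
    rw [potential, ← Finset.add_sum_erase _ _ (Finset.mem_univ k), hk, sub_zero]
  have hPc : ContinuousAt P 0 := by
    -- For α = 0, division by zero makes every term of `P` vanish.
    rcases eq_or_ne α 0 with rfl | hα
    · simp only [hP, zero_mul, div_zero]
      exact continuousAt_const
    refine tendsto_finsetSum _ fun j hj => ?_
    refine tendsto_const_nhds.div (((hnorm j).rpow_const (Or.inl (hcj j hj))).const_mul α) ?_
    exact mul_ne_zero hα (Real.rpow_pos_of_pos ((norm_nonneg _).lt_of_ne' (hcj j hj)) _).ne'
  have hGb := (hGc.tendsto.comp hlim).norm.eventually_lt_const (lt_add_one _)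
  have hPb := ((hPc.tendsto.comp hlim).const_add h).abs.eventually_lt_const (lt_add_one _)
  refine ⟨max (‖G 0‖ + 1) (|h + P 0| + 1), fun t => G (y t), ?_, hy, ?_, ?_, ?_, hlim⟩
  · filter_upwards [hfree] with t ht h0
    exact ht ⟨k, by rw [hk, h0]⟩
  · filter_upwards [hv] with t ht
    rwa [hforce] at ht
  · filter_upwards [hGb] with t ht
    exact ht.le.trans (le_max_left _ _)
  · filter_upwards [hPb, henergy] with t ht he
    rw [hpot] at he
    rw [show 1 / 2 * ‖v t‖ ^ 2 - m k / (α * ‖y t‖ ^ α) = h + P (y t) by linarith]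
    exact ht.le.trans (le_max_right _ _)

/-- Asymptotics of an ejection from collision with the center at the origin. -/
theorem exists_ejection_asymptotics {N : ℕ} {α h : ℝ} (hα : 0 < α) (hα₂ : α < 2)
    {m : Fin N → ℝ} {c : Fin N → ℂ} (hc : Function.Injective c) {k : Fin N} (hm : 0 < m k)
    (hk : c k = 0) {y v : ℝ → ℂ} {θ : ℝ → ℝ}
    (hfree : ∀ᶠ t in 𝓝[>] (0 : ℝ), y t ∉ Set.range c)
    (hy : ∀ᶠ t in 𝓝[>] (0 : ℝ), HasDerivAt y (v t) t)
    (hv : ∀ᶠ t in 𝓝[>] (0 : ℝ), HasDerivAt v (force α m c (y t)) t)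
    (henergy : ∀ᶠ t in 𝓝[>] (0 : ℝ), 1 / 2 * ‖v t‖ ^ 2 - potential α m c (y t) = h)
    (hlim : Tendsto y (𝓝[>] 0) (𝓝 0))
    (hθ : ∀ᶠ t in 𝓝[>] (0 : ℝ), ContinuousAt θ t)
    (hpolar : ∀ᶠ t in 𝓝[>] (0 : ℝ), y t = ‖y t‖ * Complex.exp (θ t * Complex.I)) :
    ∃ θ₀, Tendsto θ (𝓝[>] 0) (𝓝 θ₀) ∧
      Tendsto (fun t => y t / ((t ^ (2 / (α + 2)) : ℝ) : ℂ)) (𝓝[>] 0)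
        (𝓝 (((mu α (m k) ^ (2 / (α + 2)) : ℝ) : ℂ) * Complex.exp (θ₀ * Complex.I))) ∧
      Tendsto (fun t => v t / ((t ^ (2 / (α + 2) - 1) : ℝ) : ℂ)) (𝓝[>] 0)
        (𝓝 (((2 / (α + 2) * mu α (m k) ^ (2 / (α + 2)) : ℝ) : ℂ) *
          Complex.exp (θ₀ * Complex.I))) := by
  obtain ⟨C, g, H⟩ := exists_isPerturbedCollision hc hk hfree hy hv henergy hlim
  obtain ⟨θ₀, h₀⟩ := H.exists_tendsto_polarAngle hα hα₂ hm hθ hpolar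
  exact ⟨θ₀, h₀, H.tendsto_position hα hα₂ hm h₀ hpolar, H.tendsto_velocity hα hα₂ hm h₀ hpolar⟩

/-! ### Blow-ups and the limit profile. -/

/-- If `F t ~ t ^ q L` at `0⁺`, then the blow-ups `r ^ (-q) F (r t)` converge to `t ^ q L`, uniformly
on bounded sets of positive times on which `t ^ q` is bounded. -/
theorem eventually_norm_blowup_sub_lt {F : ℝ → ℂ} {q T M : ℝ} {L : ℂ} {S : Set ℝ} {r : ℕ → ℝ}
    (hF : Tendsto (fun t => F t / ((t ^ q : ℝ) : ℂ)) (𝓝[>] 0) (𝓝 L))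
    (hS : S ⊆ Set.Ioc 0 T) (hM : ∀ t ∈ S, t ^ q ≤ M)
    (hr : ∀ n, 0 < r n) (hr₀ : Tendsto r atTop (𝓝 0)) {ε : ℝ} (hε : 0 < ε) :
    ∀ᶠ n in atTop, ∀ t ∈ S,
      ‖((r n ^ (-q) : ℝ) : ℂ) * F (r n * t) - ((t ^ q : ℝ) : ℂ) * L‖ < ε := by
  have hM' : 0 < |M| + 1 := by positivity
  obtain ⟨a, ha, H⟩ := exists_forall_Ioo_of_eventually_nhdsGT
    (Metric.tendsto_nhds.1 hF (ε / (|M| + 1)) (by positivity))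
  have hrT : Tendsto (fun n => r n * T) atTop (𝓝 0) := by simpa using hr₀.mul_const T
  filter_upwards [hrT.eventually_lt_const ha] with n hn t ht
  have ht0 : 0 < t := (hS ht).1
  have hs : r n * t ∈ Set.Ioo 0 a :=
    ⟨mul_pos (hr n) ht0, (mul_le_mul_of_nonneg_left (hS ht).2 (hr n).le).trans_lt hn⟩
  have hb := H _ hs
  rw [dist_eq_norm] at hb
  have hq := Real.rpow_pos_of_pos ht0 q
  have hrq := Real.rpow_pos_of_pos (hr n) q
  have e : ((r n ^ (-q) : ℝ) : ℂ) * F (r n * t) - ((t ^ q : ℝ) : ℂ) * L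
      = ((t ^ q : ℝ) : ℂ) * (F (r n * t) / (((r n * t) ^ q : ℝ) : ℂ) - L) := by
    rw [Real.mul_rpow (hr n).le ht0.le, Real.rpow_neg (hr n).le]
    have h1 : ((t ^ q : ℝ) : ℂ) ≠ 0 := by exact_mod_cast hq.ne'
    have h2 : ((r n ^ q : ℝ) : ℂ) ≠ 0 := by exact_mod_cast hrq.ne'
    push_cast only [Complex.ofReal_mul, Complex.ofReal_inv]
    field_simp
  rw [e, norm_mul, Complex.norm_real, Real.norm_of_nonneg hq.le]
  calc t ^ q * _ ≤ (|M| + 1) * ‖F (r n * t) / (((r n * t) ^ q : ℝ) : ℂ) - L‖ := by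
        gcongr
        linarith [hM t ht, le_abs_self M]
    _ < (|M| + 1) * (ε / (|M| + 1)) := by gcongr
    _ = ε := by field_simp

theorem collisionEjection_of_pos {α m₁ φm φp t : ℝ} (hμ : 0 ≤ mu α m₁) (ht : 0 < t) :
    collisionEjection α m₁ φm φp t = ((t ^ (2 / (α + 2)) : ℝ) : ℂ) *
      (((mu α m₁ ^ (2 / (α + 2)) : ℝ) : ℂ) * Complex.exp (φp * Complex.I)) := by
  rw [collisionEjection, if_pos ht.le, abs_of_pos ht, Real.mul_rpow hμ ht.le]
  push_cast only [Complex.ofReal_mul]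
  ring

theorem collisionEjection_of_neg {α m₁ φm φp t : ℝ} (hμ : 0 ≤ mu α m₁) (ht : t < 0) :
    collisionEjection α m₁ φm φp t = (((-t) ^ (2 / (α + 2)) : ℝ) : ℂ) *
      (((mu α m₁ ^ (2 / (α + 2)) : ℝ) : ℂ) * Complex.exp (φm * Complex.I)) := by
  rw [collisionEjection, if_neg ht.not_ge, abs_of_neg ht,
    Real.mul_rpow hμ (neg_nonneg.2 ht.le)]
  push_cast only [Complex.ofReal_mul]
  ring

theorem deriv_collisionEjection_of_pos {α m₁ φm φp t : ℝ} (hμ : 0 ≤ mu α m₁) (ht : 0 < t) :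
    deriv (collisionEjection α m₁ φm φp) t = ((t ^ (2 / (α + 2) - 1) : ℝ) : ℂ) *
      (((2 / (α + 2) * mu α m₁ ^ (2 / (α + 2)) : ℝ) : ℂ) * Complex.exp (φp * Complex.I)) := by
  have h1 := ((Real.hasDerivAt_rpow_const (p := 2 / (α + 2)) (Or.inl ht.ne')).ofReal_comp.mul_const
    (((mu α m₁ ^ (2 / (α + 2)) : ℝ) : ℂ) * Complex.exp (φp * Complex.I)))
  refine (h1.congr_of_eventuallyEq ?_).deriv.trans ?_
  · filter_upwards [Ioi_mem_nhds ht] with s hs using collisionEjection_of_pos hμ hs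
  · push_cast only [Complex.ofReal_mul]
    ring

theorem deriv_collisionEjection_of_neg {α m₁ φm φp t : ℝ} (hμ : 0 ≤ mu α m₁) (ht : t < 0) :
    deriv (collisionEjection α m₁ φm φp) t = -((((-t) ^ (2 / (α + 2) - 1) : ℝ) : ℂ) *
      (((2 / (α + 2) * mu α m₁ ^ (2 / (α + 2)) : ℝ) : ℂ) * Complex.exp (φm * Complex.I))) := by
  have h0 := (hasDerivAt_neg t).rpow_const (p := 2 / (α + 2)) (Or.inl (neg_ne_zero.2 ht.ne))
  have h1 := h0.ofReal_comp.mul_const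
    (((mu α m₁ ^ (2 / (α + 2)) : ℝ) : ℂ) * Complex.exp (φm * Complex.I))
  refine (h1.congr_of_eventuallyEq ?_).deriv.trans ?_
  · filter_upwards [Iio_mem_nhds ht] with s hs using collisionEjection_of_neg hμ hs
  · push_cast only [Complex.ofReal_mul, Complex.ofReal_neg, Complex.ofReal_one]
    ring

theorem deriv_rescale {α r t : ℝ} {y : ℝ → ℂ} {y' : ℂ} (hr : 0 < r) (hy : HasDerivAt y y' (r * t)) :
    deriv (rescale α r y) t = ((r ^ (-(2 / (α + 2) - 1)) : ℝ) : ℂ) * y' := by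
  have h1 : HasDerivAt (fun s => y (r * s)) (r • y') t := by
    have := (hasDerivAt_id t).const_mul r
    rw [mul_one] at this
    exact hy.scomp t this
  refine (h1.const_mul ((r ^ (-(2 / (2 + α))) : ℝ) : ℂ)).deriv.trans ?_
  rw [Complex.real_smul, ← mul_assoc, ← Complex.ofReal_mul]
  nth_rewrite 2 [← Real.rpow_one r]
  rw [← Real.rpow_add hr, add_comm 2 α]
  congr 3
  ring

end NCenter

/-! ### Asymptotics on both sides of the collision. -/

namespace NCenter

open Filter Topology

section Solution

variable {N : ℕ} {α δ : ℝ} {m : Fin N → ℝ} {c : Fin N → ℂ} {y : ℝ → ℂ}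

theorem IsIsolatedCollisionSolution.hasDerivAt
    (hy : IsIsolatedCollisionSolution α m c 0 δ y) {t : ℝ} (ht : t ∈ Set.Ioo (-δ) δ)
    (h0 : t ≠ 0) : HasDerivAt y (derivWithin y (Set.Icc (0 - δ) (0 + δ)) t) t := by
  refine (hy.differentiable t ?_ h0).hasDerivWithinAt.hasDerivAt ?_
  · simpa using Set.Ioo_subset_Icc_self ht
  · simpa using Icc_mem_nhds ht.1 ht.2

theorem IsIsolatedCollisionSolution.hasDerivAt_velocity
    (hy : IsIsolatedCollisionSolution α m c 0 δ y) {t : ℝ} (ht : t ∈ Set.Ioo (-δ) δ)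
    (h0 : t ≠ 0) :
    HasDerivAt (derivWithin y (Set.Icc (0 - δ) (0 + δ))) (force α m c (y t)) t := by
  refine (hy.equation t ?_ h0).hasDerivAt ?_
  · simpa using Set.Ioo_subset_Icc_self ht
  · simpa using Icc_mem_nhds ht.1 ht.2

theorem IsIsolatedCollisionSolution.continuousAt_zero
    (hy : IsIsolatedCollisionSolution α m c 0 δ y) : ContinuousAt y 0 :=
  hy.continuousOn.continuousAt
    (Icc_mem_nhds (by linarith [hy.delta_pos]) (by linarith [hy.delta_pos]))

theorem IsPolarAngle.continuousAt {θ : ℝ → ℝ} (hθ : IsPolarAngle δ y θ) {t : ℝ}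
    (ht : t ∈ Set.Ioo (-δ) δ) (h0 : t ≠ 0) : ContinuousAt θ t :=
  hθ.continuousOn.continuousAt (inter_mem (Icc_mem_nhds ht.1 ht.2) (isOpen_ne.mem_nhds h0))

/-- Asymptotics of an isolated collision solution after the collision. -/
theorem IsIsolatedCollisionSolution.exists_asymptotics_right (hα : 0 < α) (hα₂ : α < 2)
    (hc : Function.Injective c) {k : Fin N} (hm : 0 < m k) (hk : c k = 0)
    (hy : IsIsolatedCollisionSolution α m c 0 δ y) (hy₀ : y 0 = c k) {θ : ℝ → ℝ}
    (hθ : IsPolarAngle δ y θ) :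
    ∃ θ₀, Tendsto θ (𝓝[>] 0) (𝓝 θ₀) ∧
      Tendsto (fun t => y t / ((t ^ (2 / (α + 2)) : ℝ) : ℂ)) (𝓝[>] 0)
        (𝓝 (((mu α (m k) ^ (2 / (α + 2)) : ℝ) : ℂ) * Complex.exp (θ₀ * Complex.I))) ∧
      Tendsto (fun t => derivWithin y (Set.Icc (0 - δ) (0 + δ)) t /
          ((t ^ (2 / (α + 2) - 1) : ℝ) : ℂ)) (𝓝[>] 0)
        (𝓝 (((2 / (α + 2) * mu α (m k) ^ (2 / (α + 2)) : ℝ) : ℂ) *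
          Complex.exp (θ₀ * Complex.I))) := by
  obtain ⟨h, hh⟩ := hy.energy
  have hev : ∀ᶠ t in 𝓝[>] (0 : ℝ), t ∈ Set.Ioo (-δ) δ ∧ t ≠ 0 := by
    filter_upwards [Ioo_mem_nhdsGT hy.delta_pos] with t ht
    exact ⟨⟨by linarith [ht.1, hy.delta_pos], ht.2⟩, ht.1.ne'⟩
  have hIcc : ∀ t ∈ Set.Ioo (-δ) δ, t ∈ Set.Icc (0 - δ) (0 + δ) := fun t ht => by
    simpa using Set.Ioo_subset_Icc_self ht
  refine exists_ejection_asymptotics (h := h) hα hα₂ hc hm hk ?_ ?_ ?_ ?_ ?_ ?_ ?_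
  · exact hev.mono fun t ht => hy.collisionFree t (hIcc t ht.1) ht.2
  · exact hev.mono fun t ht => hy.hasDerivAt ht.1 ht.2
  · exact hev.mono fun t ht => hy.hasDerivAt_velocity ht.1 ht.2
  · exact hev.mono fun t ht => hh t (hIcc t ht.1) ht.2
  · have := hy.continuousAt_zero.tendsto
    rw [hy₀, hk] at this
    exact this.mono_left nhdsWithin_le_nhds
  · exact hev.mono fun t ht => hθ.continuousAt ht.1 ht.2
  · exact hev.mono fun t ht => hθ.polar t ⟨Set.Ioo_subset_Icc_self ht.1, ht.2⟩

/-- Asymptotics of an isolated collision solution before the collision, obtained by reversing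
time. -/
theorem IsIsolatedCollisionSolution.exists_asymptotics_left (hα : 0 < α) (hα₂ : α < 2)
    (hc : Function.Injective c) {k : Fin N} (hm : 0 < m k) (hk : c k = 0)
    (hy : IsIsolatedCollisionSolution α m c 0 δ y) (hy₀ : y 0 = c k) {θ : ℝ → ℝ}
    (hθ : IsPolarAngle δ y θ) :
    ∃ θ₀, Tendsto θ (𝓝[<] 0) (𝓝 θ₀) ∧
      Tendsto (fun t => y (-t) / ((t ^ (2 / (α + 2)) : ℝ) : ℂ)) (𝓝[>] 0)
        (𝓝 (((mu α (m k) ^ (2 / (α + 2)) : ℝ) : ℂ) * Complex.exp (θ₀ * Complex.I))) ∧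
      Tendsto (fun t => -derivWithin y (Set.Icc (0 - δ) (0 + δ)) (-t) /
          ((t ^ (2 / (α + 2) - 1) : ℝ) : ℂ)) (𝓝[>] 0)
        (𝓝 (((2 / (α + 2) * mu α (m k) ^ (2 / (α + 2)) : ℝ) : ℂ) *
          Complex.exp (θ₀ * Complex.I))) := by
  obtain ⟨h, hh⟩ := hy.energy
  have hev : ∀ᶠ t in 𝓝[>] (0 : ℝ), -t ∈ Set.Ioo (-δ) δ ∧ -t ≠ 0 := by
    filter_upwards [Ioo_mem_nhdsGT hy.delta_pos] with t ht
    exact ⟨⟨by linarith [ht.2], by linarith [ht.1, hy.delta_pos]⟩, neg_ne_zero.2 ht.1.ne'⟩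
  have hIcc : ∀ t ∈ Set.Ioo (-δ) δ, t ∈ Set.Icc (0 - δ) (0 + δ) := fun t ht => by
    simpa using Set.Ioo_subset_Icc_self ht
  have hneg : Tendsto (fun t : ℝ => -t) (𝓝[>] 0) (𝓝 0) := by
    simpa using (continuous_neg.tendsto (0 : ℝ)).mono_left nhdsWithin_le_nhds
  obtain ⟨θ₀, h₀, h₁⟩ := exists_ejection_asymptotics (α := α) (m := m) (c := c) (h := h) hα hα₂
    hc hm hk (y := fun t => y (-t))
    (v := fun t => -derivWithin y (Set.Icc (0 - δ) (0 + δ)) (-t)) (θ := fun t => θ (-t))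
    (hev.mono fun t ht => hy.collisionFree _ (hIcc _ ht.1) ht.2)
    (hev.mono fun t ht => by
      have := (hy.hasDerivAt ht.1 ht.2).scomp t (hasDerivAt_neg t)
      rwa [neg_one_smul] at this)
    (hev.mono fun t ht => by
      have := ((hy.hasDerivAt_velocity ht.1 ht.2).scomp t (hasDerivAt_neg t)).neg
      rwa [neg_one_smul, neg_neg] at this)
    (hev.mono fun t ht => by
      rw [norm_neg]
      exact hh _ (hIcc _ ht.1) ht.2)
    (by
      have := hy.continuousAt_zero.tendsto.comp hneg
      rwa [hy₀, hk] at this)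
    (hev.mono fun t ht =>
      ContinuousAt.comp (f := fun t : ℝ => -t) (hθ.continuousAt ht.1 ht.2)
        continuous_neg.continuousAt)
    (hev.mono fun t ht => hθ.polar _ ⟨Set.Ioo_subset_Icc_self ht.1, ht.2⟩)
  refine ⟨θ₀, ?_, h₁⟩
  have hn : Tendsto (fun t : ℝ => -t) (𝓝[<] 0) (𝓝[>] 0) := by
    simpa using tendsto_neg_nhdsLT (a := (0 : ℝ))
  simpa [Function.comp_def] using h₀.comp hn

end Solution

/-! ### Uniform convergence of the rescaled curves and velocities. -/

theorem tendstoUniformlyOn_rescale {α m₁ φm φp T : ℝ} (hα : 0 < α) (hm : 0 < m₁) {y : ℝ → ℂ}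
    (hy₀ : y 0 = 0)
    (hp : Tendsto (fun t => y t / ((t ^ (2 / (α + 2)) : ℝ) : ℂ)) (𝓝[>] 0)
      (𝓝 (((mu α m₁ ^ (2 / (α + 2)) : ℝ) : ℂ) * Complex.exp (φp * Complex.I))))
    (hn : Tendsto (fun t => y (-t) / ((t ^ (2 / (α + 2)) : ℝ) : ℂ)) (𝓝[>] 0)
      (𝓝 (((mu α m₁ ^ (2 / (α + 2)) : ℝ) : ℂ) * Complex.exp (φm * Complex.I))))
    {r : ℕ → ℝ} (hr : ∀ n, 0 < r n) (hr₀ : Tendsto r atTop (𝓝 0)) :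
    TendstoUniformlyOn (fun n => rescale α (r n) y) (collisionEjection α m₁ φm φp) atTop
      (Set.Icc (-T) T) := by
  have hμ := (mu_pos hα hm).le
  have hβ : 0 < 2 / (α + 2) := by positivity
  have hM : ∀ t ∈ Set.Ioc 0 T, t ^ (2 / (α + 2)) ≤ T ^ (2 / (α + 2)) := fun t ht =>
    Real.rpow_le_rpow ht.1.le ht.2 hβ.le
  rw [Metric.tendstoUniformlyOn_iff]
  intro ε hε
  filter_upwards [eventually_norm_blowup_sub_lt hp subset_rfl hM hr hr₀ hε,
    eventually_norm_blowup_sub_lt hn subset_rfl hM hr hr₀ hε] with n h1 h2 t ht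
  rw [dist_comm, dist_eq_norm]
  rcases lt_trichotomy t 0 with h | rfl | h
  · have := h2 (-t) ⟨by linarith, by linarith [ht.1]⟩
    rwa [mul_neg, neg_neg, ← collisionEjection_of_neg (φp := φp) hμ h, add_comm α] at this
  · simpa [rescale, hy₀, collisionEjection, Real.zero_rpow hβ.ne'] using hε
  · have := h1 t ⟨h, ht.2⟩
    rwa [← collisionEjection_of_pos (φm := φm) hμ h, add_comm α] at this

theorem tendstoUniformlyOn_deriv_rescale {α m₁ φm φp T δ : ℝ} (hα : 0 < α) (hm : 0 < m₁)
    {y v : ℝ → ℂ} (hy : ∀ t ∈ Set.Ioo (-δ) δ, t ≠ 0 → HasDerivAt y (v t) t)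
    (hp : Tendsto (fun t => v t / ((t ^ (2 / (α + 2) - 1) : ℝ) : ℂ)) (𝓝[>] 0)
      (𝓝 (((2 / (α + 2) * mu α m₁ ^ (2 / (α + 2)) : ℝ) : ℂ) * Complex.exp (φp * Complex.I))))
    (hn : Tendsto (fun t => -v (-t) / ((t ^ (2 / (α + 2) - 1) : ℝ) : ℂ)) (𝓝[>] 0)
      (𝓝 (((2 / (α + 2) * mu α m₁ ^ (2 / (α + 2)) : ℝ) : ℂ) * Complex.exp (φm * Complex.I))))
    {r : ℕ → ℝ} (hr : ∀ n, 0 < r n) (hr₀ : Tendsto r atTop (𝓝 0)) (hrT : ∀ n, r n * T < δ)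
    {K : Set ℝ} (hK : IsCompact K) (hKT : K ⊆ Set.Icc (-T) T \ {0}) :
    TendstoUniformlyOn (fun n => deriv (rescale α (r n) y))
      (deriv (collisionEjection α m₁ φm φp)) atTop K := by
  have hμ := (mu_pos hα hm).le
  have hcont : ContinuousOn (fun t : ℝ => |t| ^ (2 / (α + 2) - 1)) K := fun t ht =>
    (continuous_abs.continuousAt.rpow_const
      (Or.inl (abs_ne_zero.2 (hKT ht).2))).continuousWithinAt
  -- The exponent 2/(α+2) - 1 is negative, so a bound needs `K` to stay away from 0.
  obtain ⟨M, hM⟩ := hK.exists_bound_of_continuousOn hcont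
  rw [Metric.tendstoUniformlyOn_iff]
  intro ε hε
  have hSp : {t | 0 < t ∧ t ∈ K} ⊆ Set.Ioc 0 T := fun t ht => ⟨ht.1, (hKT ht.2).1.2⟩
  have hSn : {t | 0 < t ∧ -t ∈ K} ⊆ Set.Ioc 0 T := fun t ht =>
    ⟨ht.1, neg_le_neg_iff.1 (hKT ht.2).1.1⟩
  filter_upwards [eventually_norm_blowup_sub_lt hp hSp (fun t ht => by
      have := (le_abs_self _).trans (hM t ht.2)
      rwa [abs_of_pos ht.1] at this) hr hr₀ hε,
    eventually_norm_blowup_sub_lt hn hSn (fun t ht => by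
      have := (le_abs_self _).trans (hM (-t) ht.2)
      rwa [abs_neg, abs_of_pos ht.1] at this) hr hr₀ hε] with n h1 h2 t ht
  have ht0 : t ≠ 0 := (hKT ht).2
  have htT := (hKT ht).1
  have hd : HasDerivAt y (v (r n * t)) (r n * t) := by
    refine hy _ ⟨?_, ?_⟩ (mul_ne_zero (hr n).ne' ht0)
    · nlinarith [hr n, htT.1, hrT n]
    · nlinarith [hr n, htT.2, hrT n]
  rw [dist_comm, dist_eq_norm, deriv_rescale (hr n) hd]
  rcases lt_or_gt_of_ne ht0 with h | h
  · have := h2 (-t) ⟨neg_pos.2 h, by rwa [neg_neg]⟩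
    rw [mul_neg (r n), neg_neg] at this
    rw [deriv_collisionEjection_of_neg hμ h, ← norm_neg, neg_sub', ← mul_neg, neg_neg]
    exact this
  · rw [deriv_collisionEjection_of_pos hμ h]
    exact h1 t ⟨h, ht⟩

end NCenter

theorem mainTheorem7 {N : ℕ} (α : ℝ) (hα₁ : 1 ≤ α) (hα₂ : α < 2)
    (m : Fin N → ℝ) (hm : ∀ j, 0 < m j)
    (c : Fin N → ℂ) (hc : Function.Injective c)
    (k : Fin N) (hk : c k = 0)
    (δ : ℝ) (y : ℝ → ℂ) (hy : NCenter.IsIsolatedCollisionSolution α m c 0 δ y)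
    (hy₀ : y 0 = c k)
    (θ : ℝ → ℝ) (hθ : NCenter.IsPolarAngle δ y θ) :
    ∃ θm θp : ℝ,
      Filter.Tendsto θ (nhdsWithin 0 (Set.Iio 0)) (nhds θm) ∧
      Filter.Tendsto θ (nhdsWithin 0 (Set.Ioi 0)) (nhds θp) ∧
      ∀ T : ℝ, 0 < T →
        ∃ r : ℕ → ℝ,
          StrictAnti r ∧ (∀ n, 0 < r n) ∧ Filter.Tendsto r Filter.atTop (nhds 0) ∧
          -- the rescaled curves are defined on a neighbourhood of `[-T, T]`
          (∀ n, r n * T < δ) ∧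
          TendstoUniformlyOn (fun n => NCenter.rescale α (r n) y)
            (NCenter.collisionEjection α (m k) θm θp) Filter.atTop (Set.Icc (-T) T) ∧
          ∀ K : Set ℝ, IsCompact K → K ⊆ Set.Icc (-T) T \ {0} →
            TendstoUniformlyOn (fun n => deriv (NCenter.rescale α (r n) y))
              (deriv (NCenter.collisionEjection α (m k) θm θp)) Filter.atTop K := by
  have hα : 0 < α := by linarith
  have hδ := hy.delta_pos
  obtain ⟨θm, hm₁, hm₂, hm₃⟩ := hy.exists_asymptotics_left hα hα₂ hc (hm k) hk hy₀ hθ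
  obtain ⟨θp, hp₁, hp₂, hp₃⟩ := hy.exists_asymptotics_right hα hα₂ hc (hm k) hk hy₀ hθ
  refine ⟨θm, θp, hm₁, hp₁, fun T hT => ?_⟩
  -- Any null sequence of scales would do; `T + 1` in place of `T` makes `r n * T < δ` strict
  -- already at `n = 0`.
  have hr : ∀ n : ℕ, 0 < δ / (T + 1) * (1 / ((n : ℝ) + 1)) := fun n => by positivity
  have hr₀ : Filter.Tendsto (fun n : ℕ => δ / (T + 1) * (1 / ((n : ℝ) + 1))) Filter.atTop
      (nhds 0) := by
    simpa using (tendsto_one_div_add_atTop_nhds_zero_nat (𝕜 := ℝ)).const_mul (δ / (T + 1))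
  have hrT : ∀ n : ℕ, δ / (T + 1) * (1 / ((n : ℝ) + 1)) * T < δ := fun n => by
    have h1 : 1 / ((n : ℝ) + 1) ≤ 1 := by
      rw [div_le_one (by positivity)]; linarith [n.cast_nonneg (α := ℝ)]
    calc δ / (T + 1) * (1 / ((n : ℝ) + 1)) * T ≤ δ / (T + 1) * 1 * T := by gcongr
      _ < δ := by
        rw [mul_one, div_mul_eq_mul_div, div_lt_iff₀ (by positivity)]
        nlinarith
  refine ⟨fun n => δ / (T + 1) * (1 / ((n : ℝ) + 1)), ?_, hr, hr₀, hrT, ?_, fun K hK hKT => ?_⟩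
  · intro a b hab
    have : (a : ℝ) < b := by exact_mod_cast hab
    dsimp only
    gcongr
  · exact NCenter.tendstoUniformlyOn_rescale hα (hm k) (hy₀.trans hk) hp₂ hm₂ hr hr₀
  · exact NCenter.tendstoUniformlyOn_deriv_rescale hα (hm k)
      (fun t ht h0 => hy.hasDerivAt ht h0) hp₃ hm₃ hr hr₀ hrT hK hKT
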